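/- Smallness is relative to a fixed universe of small sets. For a regular cardinal $\kappa$ (in particular, infinite), a set is called $\kappa$-small if its cardinality is $<\kappa$; a category $\mathcal{J}$ is $\kappa$-filtered if every functor to $\mathcal{J}$ from a category with fewer than $\kappa$ morphisms admits a cocone; an object $A$ of a locally small category $\mathcal{C}$ is $\kappa$-presentable if $\mathrm{Hom}_{\mathcal{C}}(A,-)$ preserves colimits of small $\kappa$-filtered diagrams, and $\mathbf{K}_\kappa(\mathcal{C})$ denotes the full subcategory of $\kappa$-presentable objects. A locally $\kappa$-presentable category is a cocomplete locally small category in which, for some small set $\mathcal{G}$ of $\kappa$-presentable objects, every object is the colimit of a small $\kappa$-filtered diagram of objects in $\mathcal{G}$; a category is locally presentable if it is locally $\kappa$-presentable for some regular cardinal $\kappa$. Two sets $\mathcal{I},\mathcal{I}'$ of morphisms of a model category cofibrantly generate its model structure if the trivial fibrations are precisely the morphisms with the right lifting property with respect to $\mathcal{I}$ and the fibrations are precisely the morphisms with the right lifting property with respect to $\mathcal{I}'$. A combinatorial model category is a locally presentable category equipped with a model structure that is cofibrantly generated by some small sets of morphisms. For regular cardinals $\kappa,\lambda$, write $\kappa\vartriangleleft\lambda$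 if $\kappa<\lambda$ and, for every $\lambda$-small set $X$, the set of all $\kappa$-small subsets of $X$, partially ordered by inclusion, has a $\lambda$-small cofinal subset. A strongly $(\kappa,\lambda)$-combinatorial model category is a combinatorial model category $\mathcal{M}$ such that: 1. $\mathcal{M}$ is a locally $\kappa$-presentable category, and $\kappa\vartriangleleft\lambda$; 2. $\mathbf{K}_\lambda(\mathcal{M})$ is closed under finite limits in $\mathcal{M}$; 3. each hom-set in $\mathbf{K}_\kappa(\mathcal{M})$ is $\lambda$-small; 4. there exist $\lambda$-small sets of morphisms in $\mathbf{K}_\kappa(\mathcal{M})$ that cofibrantly generate the model structure of $\mathcal{M}$. **Proposition.** For every combinatorial model category $\mathcal{M}$, there exist regular cardinals $\kappa$ and $\lambda$ such that $\mathcal{M}$ is a strongly $(\kappa,\lambda)$-combinatorial model category. -/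

import Mathlib

universe w v u

open CategoryTheory Limits

/-- For (regular) cardinals `κ` and `lam`, `κ` is sharply less than `lam` if `κ < lam` and, for
every set `X` of cardinality `< lam`, the set of all subsets of `X` of cardinality `< κ`,
ordered by inclusion, has a cofinal subset of cardinality `< lam`. -/
structure IsSharplyLess (κ lam : Cardinal.{w}) : Prop where
  lt : κ < lam
  exists_cofinal (X : Type w) (hX : HasCardinalLT X lam) :
    ∃ Y : Set {S : Set X // HasCardinalLT S κ}, HasCardinalLT Y lam ∧ IsCofinal Y

namespace HomotopicalAlgebra

variable (C : Type u) [Category.{v} C] [ModelCategory C]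

/-- `I` and `I'` cofibrantly generate the model structure: the morphisms with the right lifting
property against `I` are the trivial fibrations, and the morphisms with the right lifting
property against `I'` are the fibrations. -/
structure CofibrantlyGenerates (I I' : MorphismProperty C) : Prop where
  rlp_eq_trivialFibrations : I.rlp = trivialFibrations C
  rlp_eq_fibrations : I'.rlp = fibrations C

/-- A combinatorial model category (relative to the universe `w` of small sets): a locally
presentable category with a model structure cofibrantly generated by small sets of morphisms. -/
structure IsCombinatorialModelCategory : Prop where
  isLocallyPresentable : IsLocallyPresentable.{w} C
  exists_generators : ∃ I I' : MorphismProperty C,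
    MorphismProperty.IsSmall.{w} I ∧ MorphismProperty.IsSmall.{w} I' ∧
      CofibrantlyGenerates C I I'

/-- A strongly `(κ, lam)`-combinatorial model category. -/
structure IsStronglyCombinatorialModelCategory (κ lam : Cardinal.{w})
    [Fact κ.IsRegular] [Fact lam.IsRegular] : Prop where
  isCombinatorial : IsCombinatorialModelCategory.{w} C
  isCardinalLocallyPresentable : IsCardinalLocallyPresentable C κ
  isSharplyLess : IsSharplyLess κ lam
  /-- The `lam`-presentable objects are closed under finite limits. -/
  isClosedUnderFiniteLimits (J : Type) [SmallCategory J] [FinCategory J] :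
    (isCardinalPresentable C lam).IsClosedUnderLimitsOfShape J
  hasCardinalLT_hom (X Y : C) (hX : IsCardinalPresentable X κ) (hY : IsCardinalPresentable Y κ) :
    HasCardinalLT (X ⟶ Y) lam
  /-- The model structure is cofibrantly generated by sets of cardinality `< lam` of morphisms
  between `κ`-presentable objects. -/
  exists_generators : ∃ I I' : MorphismProperty C,
    I.HasCardinalLT lam ∧ I'.HasCardinalLT lam ∧
      (∀ ⦃X Y : C⦄ (f : X ⟶ Y), I f → IsCardinalPresentable X κ ∧ IsCardinalPresentable Y κ) ∧
      (∀ ⦃X Y : C⦄ (f : X ⟶ Y), I' f → IsCardinalPresentable X κ ∧ IsCardinalPresentable Y κ) ∧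
      CofibrantlyGenerates C I I'

end HomotopicalAlgebra

/-! Take `κ` so large that `C` is locally `κ`-presentable with generating morphisms between
`κ`-presentable objects, then `lam = (2 ^ μ)⁺`, where `μ ≥ κ` bounds the generators, representatives
of the `κ`-presentable objects and their hom-sets. Sharpness follows from `(2 ^ μ) ^ μ = 2 ^ μ`. The
main point is closure under finite limits. It rests on a criterion: `X` is `lam`-presentable iff `G
⟶ X` is `lam`-small for all `κ`-presentable `G`. Sharpness gives one direction (`X` is a retract of
a `lam`-small `κ`-filtered colimit of `κ`-presentables), density the other. The hom condition passes
to finite limits. -/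

lemma hasCardinalLT_pi_of_finite {ι : Type*} [Finite ι] {κ : Cardinal.{w}}
    (hκ : Cardinal.aleph0 ≤ κ) (α : ι → Type v) (hα : ∀ i, HasCardinalLT (α i) κ) :
    HasCardinalLT (∀ i, α i) κ := by
  induction ι using Finite.induction_empty_option with
  | of_equiv e h =>
    rw [← hasCardinalLT_iff_of_equiv (Equiv.piCongrLeft α e)]
    exact h (fun i ↦ α (e i)) (fun i ↦ hα _)
  | h_empty => exact hasCardinalLT_of_finite _ _ hκ
  | h_option h =>
    rw [hasCardinalLT_iff_of_equiv Equiv.piOptionEquivProd]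
    exact hasCardinalLT_prod hκ (hα _) (h _ (fun _ ↦ hα _))

/-- If `X` has at most `2 ^ μ` elements, it has at most `(2 ^ μ) ^ μ = 2 ^ μ` subsets of size `≤ μ`,
so the whole poset serves as cofinal subset. -/
lemma IsSharplyLess.succ_two_power {κ μ : Cardinal.{w}} (hμ : Cardinal.aleph0 ≤ μ)
    (hκ : κ ≤ μ) : IsSharplyLess κ (Order.succ ((2 : Cardinal.{w}) ^ μ)) where
  lt := lt_of_le_of_lt (hκ.trans (Cardinal.cantor μ).le) (Order.lt_succ _)
  exists_cofinal X hX := by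
    refine ⟨Set.univ, ?_, fun S ↦ ⟨S, Set.mem_univ _, le_rfl⟩⟩
    rw [hasCardinalLT_iff_cardinal_mk_lt, Order.lt_succ_iff] at hX ⊢
    have hμ' : Cardinal.aleph0 ≤ (2 : Cardinal.{w}) ^ μ := hμ.trans (Cardinal.cantor μ).le
    let φ : ↥(Set.univ : Set {S : Set X // HasCardinalLT S κ}) →
        {S : Set X // Cardinal.mk S ≤ μ} := fun S ↦ ⟨S.1.1,
      ((hasCardinalLT_iff_cardinal_mk_lt _ _).1 S.1.2).le.trans hκ⟩
    have hφ : Function.Injective φ := fun S T h ↦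
      Subtype.ext (Subtype.ext (Subtype.ext_iff.1 h :))
    calc
      _ ≤ Cardinal.mk {S : Set X // Cardinal.mk S ≤ μ} := Cardinal.mk_le_of_injective hφ
      _ ≤ max (Cardinal.mk X) Cardinal.aleph0 ^ μ := Cardinal.mk_bounded_set_le _ _
      _ ≤ ((2 : Cardinal.{w}) ^ μ) ^ μ := Cardinal.power_le_power_right (max_le hX hμ')
      _ = 2 ^ μ := by rw [← Cardinal.power_mul, Cardinal.mul_eq_self hμ]

namespace CategoryTheory

variable {C : Type u} [Category.{v} C]

/-! ### Decomposing a colimit over a poset along a directed family of subsets. -/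

namespace Limits

variable {α : Type w} [PartialOrder α] (F : α ⥤ C) [HasColimitsOfSize.{w, w} C]

/-- The restriction of a functor from a partially ordered type to a subset. -/
abbrev restrictToSet (B : Set α) : B ⥤ C := (Subtype.mono_coe (· ∈ B)).functor ⋙ F

/-- The morphism between colimits induced by an inclusion of sets. -/
noncomputable def colimitOnSetMap {B B' : Set α} (h : B ≤ B') :
    colimit (restrictToSet F B) ⟶ colimit (restrictToSet F B') :=
  colimit.pre (restrictToSet F B') (Monotone.functor (f := Set.inclusion h) (fun _ _ hab ↦ hab))

lemma ι_colimitOnSetMap {B B' : Set α} (h : B ≤ B') (b : B) :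
    colimit.ι (restrictToSet F B) b ≫ colimitOnSetMap F h =
      colimit.ι (restrictToSet F B') ⟨b.1, h b.2⟩ :=
  colimit.ι_pre (restrictToSet F B') (Monotone.functor (f := Set.inclusion h) (fun _ _ hab ↦ hab)) b

lemma ι_colimitOnSetMap_assoc {B B' : Set α} (h : B ≤ B') (b : B) {X : C}
    (g : colimit (restrictToSet F B') ⟶ X) :
    colimit.ι (restrictToSet F B) b ≫ colimitOnSetMap F h ≫ g =
      colimit.ι (restrictToSet F B') ⟨b.1, h b.2⟩ ≫ g := by
  rw [← Category.assoc, ι_colimitOnSetMap]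
  rfl

/-- The functor which sends a subset `B` satisfying `P` to the colimit of the restriction
of a given functor to `B`. -/
noncomputable def colimitOnSets (P : Set α → Prop) : Subtype P ⥤ C where
  obj B := colimit (restrictToSet F B.1)
  map f := colimitOnSetMap F (leOfHom f)
  map_id B := colimit.hom_ext (fun b ↦ by rw [ι_colimitOnSetMap, Category.comp_id])
  map_comp f g := colimit.hom_ext (fun b ↦ by
    rw [ι_colimitOnSetMap, ι_colimitOnSetMap_assoc]
    exact (ι_colimitOnSetMap F (leOfHom g) ⟨b.1, leOfHom f b.2⟩).symm)

variable {F} {P : Set α → Prop}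

namespace colimitOnSets

/-- The inclusion of `F.obj a` in the colimit of `F` on a set which contains `a`. -/
noncomputable def ι (B : Subtype P) (a : α) (ha : a ∈ B.1) :
    F.obj a ⟶ (colimitOnSets F P).obj B :=
  colimit.ι (restrictToSet F B.1) ⟨a, ha⟩

lemma w (B : Subtype P) {a b : α} (f : a ⟶ b) (ha : a ∈ B.1) (hb : b ∈ B.1) :
    F.map f ≫ ι B b hb = ι B a ha :=
  colimit.w (restrictToSet F B.1) (j := ⟨b, hb⟩) (j' := ⟨a, ha⟩) (homOfLE (leOfHom f))

lemma ι_map {B B' : Subtype P} (f : B ⟶ B') (a : α) (ha : a ∈ B.1) :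
    ι B a ha ≫ (colimitOnSets F P).map f = ι B' a (leOfHom f ha) :=
  ι_colimitOnSetMap F (leOfHom f) ⟨a, ha⟩

lemma ι_map_assoc {B B' : Subtype P} (f : B ⟶ B') (a : α) (ha : a ∈ B.1) {X : C}
    (g : (colimitOnSets F P).obj B' ⟶ X) :
    ι B a ha ≫ (colimitOnSets F P).map f ≫ g = ι B' a (leOfHom f ha) ≫ g := by
  rw [← Category.assoc, ι_map]

lemma hom_ext {B : Subtype P} {X : C} {f g : (colimitOnSets F P).obj B ⟶ X}
    (h : ∀ (a : α) (ha : a ∈ B.1), ι B a ha ≫ f = ι B a ha ≫ g) : f = g :=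
  colimit.hom_ext (fun a ↦ h a.1 a.2)

/-- The morphism from the colimit of `F` on a set induced by a cocone over `F`. -/
noncomputable def desc (B : Subtype P) (c : Cocone F) : (colimitOnSets F P).obj B ⟶ c.pt :=
  colimit.desc (restrictToSet F B.1) (c.whisker (Subtype.mono_coe (· ∈ B.1)).functor)

lemma ι_desc (B : Subtype P) (c : Cocone F) (a : α) (ha : a ∈ B.1) :
    ι B a ha ≫ desc B c = c.ι.app a :=
  colimit.ι_desc _ _

lemma ι_desc_assoc (B : Subtype P) (c : Cocone F) (a : α) (ha : a ∈ B.1) {X : C}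
    (g : c.pt ⟶ X) : ι B a ha ≫ desc B c ≫ g = c.ι.app a ≫ g := by
  rw [← Category.assoc, ι_desc]

variable (P) in
/-- The cocone over `colimitOnSets F P` induced by a cocone over `F`. -/
noncomputable def cocone (c : Cocone F) : Cocone (colimitOnSets F P) where
  pt := c.pt
  ι :=
    { app B := desc B c
      naturality B B' f := hom_ext (fun a ha ↦ by
        dsimp
        rw [ι_map_assoc, ι_desc, Category.comp_id, ι_desc]) }

lemma ι_app_eq (s : Cocone (colimitOnSets F P)) [IsDirectedOrder (Subtype P)] (B B' : Subtype P)
    (a : α) (h : a ∈ B.1) (h' : a ∈ B'.1) :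
    ι B a h ≫ s.ι.app B = ι B' a h' ≫ s.ι.app B' := by
  obtain ⟨B'', h₁, h₂⟩ := directed_of (· ≤ ·) B B'
  rw [← s.w (homOfLE h₁), ← s.w (homOfLE h₂), ι_map_assoc, ι_map_assoc]

/-- A colimit over a partially ordered type `α` is the colimit of the colimits over the members
of a directed family of subsets of `α` such that any two elements belong to a member. -/
noncomputable def isColimitCocone {c : Cocone F} (hc : IsColimit c)
    [IsDirectedOrder (Subtype P)] (hP : ∀ a b : α, ∃ B : Subtype P, a ∈ B.1 ∧ b ∈ B.1) :
    IsColimit (cocone P c) := by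
  choose S hS _ using fun a ↦ hP a a
  -- By directedness the component at `a` does not depend on the chosen `S a`; naturality is checked
  -- in a member containing both `a` and `b`.
  let d (s : Cocone (colimitOnSets F P)) : Cocone F :=
    { pt := s.pt
      ι :=
        { app a := ι (S a) a (hS a) ≫ s.ι.app (S a)
          naturality a b f := by
            obtain ⟨B, ha, hb⟩ := hP a b
            dsimp
            rw [ι_app_eq s _ B a _ ha, ι_app_eq s _ B b _ hb, ← w B f ha hb, Category.comp_id,
              Category.assoc] } }
  exact
    { desc s := hc.desc (d s)
      fac s B := hom_ext (fun a ha ↦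
        (ι_desc_assoc B c a ha _).trans ((hc.fac (d s) a).trans (ι_app_eq s _ _ _ _ _)))
      uniq s m hm := hc.hom_ext (fun a ↦
        (ι_desc_assoc (S a) c a (hS a) m).symm.trans
          ((ι (S a) a (hS a) ≫= hm (S a)).trans (hc.fac (d s) a).symm)) }

end colimitOnSets

end Limits

open Limits

/-! ### Detecting `lam`-presentability by the size of hom-sets. -/

variable {κ lam : Cardinal.{w}} [Fact κ.IsRegular] [Fact lam.IsRegular]

/-- Present `X` over a `κ`-directed poset. By sharpness its `lam`-small `κ`-directed subsets form a
`lam`-directed family, so `𝟙 X` factors through the colimit over one of them. -/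
lemma IsCardinalPresentable.exists_retract_of_isSharplyLess (h : IsSharplyLess κ lam)
    [IsCardinalLocallyPresentable C κ] (X : C) [IsCardinalPresentable X lam] :
    ∃ (J : Type w) (_ : PartialOrder J) (_ : IsCardinalFiltered J κ) (_ : HasCardinalLT J lam)
      (Y : C) (_ : (isCardinalPresentable C κ).ColimitOfShape J Y), Nonempty (Retract X Y) := by
  obtain ⟨J, _, _, ⟨p⟩⟩ :=
    (isCardinalFilteredGenerator_isCardinalPresentable C κ).exists_colimitsOfShape X
  obtain ⟨α, _, _, G, _⟩ := IsCardinalFiltered.exists_cardinal_directed J κ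
  let q := p.reindex G
  let P : Set α → Prop := fun B ↦ IsCardinalFiltered B κ ∧ HasCardinalLT B lam
  have hP (A : Set α) (hA : HasCardinalLT A lam) : ∃ B : Subtype P, A ⊆ B.1 := by
    obtain ⟨B, hAB, hB, hB'⟩ :=
      Cardinal.SharplyLT.exists_isCardinalFiltered_set_of_exists_cofinal h.lt h.exists_cofinal A hA
    exact ⟨⟨B, hB, hB'⟩, hAB⟩
  have : IsCardinalFiltered (Subtype P) lam := isCardinalFiltered_preorder _ _ (fun K f hK ↦ by
    obtain ⟨B, hB⟩ := hP (⋃ k, (f k).1) (hasCardinalLT_iUnion _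
      (by rwa [hasCardinalLT_iff_cardinal_mk_lt]) (fun k ↦ (f k).2.2))
    exact ⟨B, fun k ↦ (Set.subset_iUnion (fun k ↦ (f k).1) k).trans hB⟩)
  have := isFiltered_of_isCardinalFiltered (Subtype P) lam
  have : IsDirectedOrder (Subtype P) := IsFiltered.isDirectedOrder _
  have hc := colimitOnSets.isColimitCocone (P := P) q.isColimit (fun a b ↦ by
    obtain ⟨B, hB⟩ := hP {a, b} (hasCardinalLT_of_finite _ _ (Cardinal.IsRegular.aleph0_le Fact.out))
    exact ⟨B, hB (by simp), hB (by simp)⟩)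
  obtain ⟨B, i, hi⟩ := IsCardinalPresentable.exists_hom_of_isColimit lam hc (𝟙 X)
  exact ⟨B.1, inferInstance, B.2.1, B.2.2, _,
    .colimit (restrictToSet q.diag B.1) (fun b ↦ q.prop_diag_obj b.1),
    ⟨{ i := i, r := _, retract := hi }⟩⟩

/-- With `X` a retract of `Y` as above, `G ⟶ X` embeds in `G ⟶ Y`, and every map `G ⟶ Y` factors
through a stage of the diagram. -/
lemma IsCardinalPresentable.hasCardinalLT_hom_of_isSharplyLess (h : IsSharplyLess κ lam)
    [IsCardinalLocallyPresentable C κ]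
    (hκ : ∀ (X Y : C) [IsCardinalPresentable X κ] [IsCardinalPresentable Y κ],
      HasCardinalLT (X ⟶ Y) lam)
    (G X : C) [IsCardinalPresentable G κ] [IsCardinalPresentable X lam] :
    HasCardinalLT (G ⟶ X) lam := by
  obtain ⟨J, _, _, hJ, Y, p, ⟨r⟩⟩ := exists_retract_of_isSharplyLess h X
  have : HasCardinalLT (G ⟶ Y) lam :=
    (hasCardinalLT_sigma (fun j ↦ G ⟶ p.diag.obj j) lam hJ (fun j ↦
      have : IsCardinalPresentable (p.diag.obj j) κ := p.prop_diag_obj j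
      hκ _ _)).of_surjective (fun x ↦ x.2 ≫ p.ι.app x.1) (fun f ↦ by
        obtain ⟨j, g, hg⟩ := IsCardinalPresentable.exists_hom_of_isColimit κ p.isColimit f
        exact ⟨⟨j, g⟩, hg⟩)
  exact this.of_injective (fun f ↦ f ≫ r.i) (fun f g hfg ↦ by
    simpa using hfg =≫ r.r)

/-- By density, `X` is the canonical colimit of the objects of `Q` over it; the indexing category
has fewer than `lam` arrows, and `lam`-small colimits of `lam`-presentables are `lam`-presentable.
-/
lemma isCardinalPresentable_of_hasCardinalLT_hom (h : κ ≤ lam)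
    [IsCardinalLocallyPresentable C κ] (Q : ObjectProperty C)
    (hQ : Q ≤ isCardinalPresentable C κ) (hQ' : isCardinalPresentable C κ ≤ Q.isoClosure)
    (hlam : HasCardinalLT (Subtype Q) lam)
    (hκ : ∀ (X Y : C) [IsCardinalPresentable X κ] [IsCardinalPresentable Y κ],
      HasCardinalLT (X ⟶ Y) lam) (X : C)
    (hX : ∀ (G : C) [IsCardinalPresentable G κ], HasCardinalLT (G ⟶ X) lam) :
    IsCardinalPresentable X lam := by
  have : (ObjectProperty.ιOfLE hQ).IsEquivalence :=
    { essSurj := ⟨fun Y ↦ by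
        obtain ⟨Z, hZ, ⟨e⟩⟩ := hQ' _ Y.2
        exact ⟨⟨Z, hZ⟩, ⟨(isCardinalPresentable C κ).fullyFaithfulι.preimageIso e.symm⟩⟩⟩ }
  have : Q.ι.IsDense :=
    inferInstanceAs (ObjectProperty.ιOfLE hQ ⋙ (isCardinalPresentable C κ).ι).IsDense
  have hQ'' (Y : Q.FullSubcategory) : IsCardinalPresentable Y.obj κ := hQ _ Y.2
  have hQ₃ : HasCardinalLT Q.FullSubcategory lam :=
    hlam.of_surjective (fun Y ↦ ⟨Y.1, Y.2⟩) (fun Y ↦ ⟨⟨Y.1, Y.2⟩, rfl⟩)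
  have hobj : HasCardinalLT (CostructuredArrow Q.ι X) lam :=
    (hasCardinalLT_sigma (fun (Y : Q.FullSubcategory) ↦ Y.obj ⟶ X) lam hQ₃
      (fun Y ↦ hX _)).of_surjective (fun y ↦ CostructuredArrow.mk (S := Q.ι) (Y := y.1) y.2)
        (fun y ↦ ⟨⟨y.left, y.hom⟩, rfl⟩)
  have harrow : HasCardinalLT (Arrow (CostructuredArrow Q.ι X)) lam :=
    (hasCardinalLT_sigma (fun (y : CostructuredArrow Q.ι X × CostructuredArrow Q.ι X) ↦
      (y.1 ⟶ y.2)) lam (hasCardinalLT_prod (Cardinal.IsRegular.aleph0_le Fact.out) hobj hobj)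
      (fun y ↦ (hκ y.1.left.obj y.2.left.obj).of_injective (fun f ↦ f.left.hom)
        (fun f g hfg ↦ by
          ext
          exact hfg))).of_surjective (fun f ↦ Arrow.mk f.2)
            (fun f ↦ ⟨⟨⟨f.left, f.right⟩, f.hom⟩, rfl⟩)
  have := hobj.small
  have := essentiallySmall_of_small_of_locallySmall.{w} (CostructuredArrow Q.ι X)
  have : HasLimitsOfShape (CostructuredArrow Q.ι X)ᵒᵖ (Type w) :=
    hasLimitsOfShape_of_essentiallySmall.{w, w} _ _
  have (Y : CostructuredArrow Q.ι X) :
      IsCardinalPresentable ((CostructuredArrow.proj Q.ι X ⋙ Q.ι).obj Y) lam :=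
    isCardinalPresentable_of_le (κ := κ) Y.left.obj h
  exact isCardinalPresentable_of_isColimit _ (Q.ι.denseAt X) lam harrow

/-- Maps from `G` to a limit embed in the product of the hom-sets to the terms, so only finiteness
of the objects of `J` matters. -/
lemma isClosedUnderLimitsOfShape_isCardinalPresentable_of_isSharplyLess
    (h : IsSharplyLess κ lam) [IsCardinalLocallyPresentable C κ] (Q : ObjectProperty C)
    (hQ : Q ≤ isCardinalPresentable C κ) (hQ' : isCardinalPresentable C κ ≤ Q.isoClosure)
    (hlam : HasCardinalLT (Subtype Q) lam)
    (hκ : ∀ (X Y : C) [IsCardinalPresentable X κ] [IsCardinalPresentable Y κ],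
      HasCardinalLT (X ⟶ Y) lam) (J : Type*) [Category* J] [Finite J] :
    (isCardinalPresentable C lam).IsClosedUnderLimitsOfShape J where
  limitsOfShape_le := by
    rintro X ⟨p⟩
    refine isCardinalPresentable_of_hasCardinalLT_hom h.lt.le Q hQ hQ' hlam hκ X (fun G _ ↦ ?_)
    have (j : J) : IsCardinalPresentable (p.diag.obj j) lam := p.prop_diag_obj j
    exact (hasCardinalLT_pi_of_finite (Cardinal.IsRegular.aleph0_le Fact.out)
      (fun j ↦ G ⟶ p.diag.obj j) (fun j ↦
        IsCardinalPresentable.hasCardinalLT_hom_of_isSharplyLess h hκ _ _)).of_injective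
      (fun f j ↦ f ≫ p.π.app j) (fun f g hfg ↦ p.isLimit.hom_ext (fun j ↦ congr_fun hfg j))

lemma MorphismProperty.exists_isCardinalPresentable_of_isSmall
    [∀ X : C, IsPresentable.{w} X] (W : MorphismProperty C) [MorphismProperty.IsSmall.{w} W] :
    ∃ κ : Cardinal.{w}, κ.IsRegular ∧ ∀ (κ' : Cardinal.{w}) [Fact κ'.IsRegular], κ ≤ κ' →
      ∀ ⦃X Y : C⦄ (f : X ⟶ Y), W f → IsCardinalPresentable X κ' ∧ IsCardinalPresentable Y κ' := by
  choose rank hrank hrank' using fun X : C ↦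
    Functor.IsAccessible.exists_cardinal.{w} (F := coyoneda.obj (Opposite.op X))
  -- Ranks are turned into types of that cardinality; the sum bounds source and target at once.
  obtain ⟨κ, hκ, hW⟩ := HasCardinalLT.exists_regular_cardinal_forall.{w}
    (fun f : W.toSet ↦ (rank f.1.left).ord.ToType ⊕ (rank f.1.right).ord.ToType)
  refine ⟨κ, hκ, fun κ' _ hκ' X Y f hf ↦ ?_⟩
  have hle := hW ⟨CategoryTheory.Arrow.mk f, hf⟩
  rw [hasCardinalLT_sum_iff _ _ _ hκ.aleph0_le] at hle
  simp only [hasCardinalLT_iff_cardinal_mk_lt, Cardinal.mk_ord_toType] at hle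
  have hX := hrank' X
  have hY := hrank' Y
  exact ⟨isCardinalPresentable_of_le (κ := rank X) X (by exact hle.1.le.trans hκ'),
    isCardinalPresentable_of_le (κ := rank Y) Y (by exact hle.2.le.trans hκ')⟩

end CategoryTheory

theorem mainTheorem11 (C : Type u) [Category.{v} C] [HomotopicalAlgebra.ModelCategory C]
    (hC : HomotopicalAlgebra.IsCombinatorialModelCategory.{w} C) :
    ∃ (κ lam : Cardinal.{w}) (_ : Fact κ.IsRegular) (_ : Fact lam.IsRegular),
      HomotopicalAlgebra.IsStronglyCombinatorialModelCategory C κ lam := by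
  have := hC.isLocallyPresentable
  obtain ⟨I, I', _, _, hI⟩ := hC.exists_generators
  obtain ⟨κ₀, _, _⟩ := IsLocallyPresentable.exists_cardinal.{w} C
  have : MorphismProperty.IsSmall.{w} (I ⊔ I') :=
    ⟨by rw [MorphismProperty.toSet_max]; infer_instance⟩
  obtain ⟨κ₁, hκ₁, h₁⟩ := (I ⊔ I').exists_isCardinalPresentable_of_isSmall.{w}
  let κ := max κ₀ κ₁
  -- The maximum is one of the two regular cardinals.
  have hκ : Fact κ.IsRegular := ⟨iteInduction (fun _ ↦ hκ₁) (fun _ ↦ Fact.out)⟩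
  have : IsCardinalLocallyPresentable C κ := .of_le C (le_max_left κ₀ κ₁)
  obtain ⟨Q, _, hQ, hQ'⟩ :=
    ObjectProperty.EssentiallySmall.exists_small_le.{w} (isCardinalPresentable C κ)
  obtain ⟨μ₁, hμ₁, hhom⟩ := HasCardinalLT.exists_regular_cardinal_forall.{w}
    (fun (X : Subtype Q × Subtype Q) ↦ (X.1.1 ⟶ X.2.1))
  obtain ⟨μ₂, hμ₂, hobj⟩ := HasCardinalLT.exists_regular_cardinal.{w} (Subtype Q)
  obtain ⟨μ₃, hμ₃, hgen⟩ := HasCardinalLT.exists_regular_cardinal.{w} (I ⊔ I').toSet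
  let μ := max κ (max μ₁ (max μ₂ μ₃))
  have hμ : Cardinal.aleph0 ≤ μ := hκ.out.aleph0_le.trans (le_max_left _ _)
  let lam := Order.succ ((2 : Cardinal.{w}) ^ μ)
  have hlam : Fact lam.IsRegular :=
    ⟨Cardinal.isRegular_succ (hμ.trans (Cardinal.cantor μ).le)⟩
  have hμlam : μ ≤ lam := (Cardinal.cantor μ).le.trans (Order.le_succ _)
  have hle₁ : μ₁ ≤ lam := le_trans (by simp [μ]) hμlam
  have hle₂ : μ₂ ≤ lam := le_trans (by simp [μ]) hμlam
  have hle₃ : μ₃ ≤ lam := le_trans (by simp [μ]) hμlam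
  have hsharp : IsSharplyLess κ lam := .succ_two_power hμ (le_max_left _ _)
  have hhom' (X Y : C) [hX : IsCardinalPresentable X κ] [hY : IsCardinalPresentable Y κ] :
      HasCardinalLT (X ⟶ Y) lam := by
    obtain ⟨X', hX', ⟨e⟩⟩ := hQ' X hX
    obtain ⟨Y', hY', ⟨e'⟩⟩ := hQ' Y hY
    rw [hasCardinalLT_iff_of_equiv (Iso.homCongr e e')]
    exact (hhom ⟨⟨X', hX'⟩, ⟨Y', hY'⟩⟩).of_le hle₁
  have hgen' := hgen.of_le hle₃
  refine ⟨κ, lam, hκ, hlam, hC, inferInstance, hsharp, fun J _ _ ↦ ?_,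
    fun X Y _ _ ↦ hhom' X Y, I, I', ?_, ?_, ?_, ?_, hI⟩
  · exact isClosedUnderLimitsOfShape_isCardinalPresentable_of_isSharplyLess hsharp Q hQ hQ'
      (hobj.of_le hle₂) hhom' J
  · exact hgen'.of_injective (Set.inclusion fun f hf ↦ Or.inl hf) (Set.inclusion_injective _)
  · exact hgen'.of_injective (Set.inclusion fun f hf ↦ Or.inr hf) (Set.inclusion_injective _)
  · exact fun X Y f hf ↦ h₁ κ (le_max_right _ _) f (Or.inl hf)
  · exact fun X Y f hf ↦ h₁ κ (le_max_right _ _) f (Or.inr hf)
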